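/- **Conventions.** Formulas are first-order formulas over $(\mathbb R,0,1,+,*,=,<)$ with the standard semantics; $\varphi[Z]$ represents $\mathbb S\subseteq\mathbb R^d$ if $\mathbb S=\{p : \varphi[p]\text{ holds}\}$. $\mathbb R^d$ carries the Euclidean metric $\delta$, and $B(p,\epsilon)$ is the open ball. **Hybrid automata.** A hybrid automaton $H$ of dimension $d$ consists of a finite directed graph $(\mathcal V,\mathcal E)$, formulas $Inv(v)[Z]$ and $Dyn(v)[Z,Z',T]$ for every $v\in\mathcal V$, and formulas $Act(e)[Z]$ and $Res(e)[Z,Z']$ for every $e\in\mathcal E$, such that whenever $Inv(v)[p]$ holds, $Dyn(v)[p,q,0]$ holds if and only if $p=q$. A state $\langle v,s\rangle\in\mathcal V\times\mathbb R^d$ is admissible if $Inv(v)[s]$ holds. - $\langle v,s\rangle\to_C\langle v,r\rangle$ if there are a continuous $f:\mathbb R_{\ge0}\to\mathbb R^d$ and $t\ge0$ with $f(0)=s$, $f(t)=r$, such that $Inv(v)[f(t')]$ and $Dyn(v)[s,f(t'),t']$ hold for all $t'\in[0,t]$. - $\langle v,s\rangle\to_D\langle u,r\rangle$ if $(v,u)\in\mathcal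 E$ and $Act((v,u))[s]$ and $Res((v,u))[s,r]$ hold. A trace of length $n\ge1$ is a sequence of admissible states $\ell_0,\dots,\ell_n$ such that $\ell_{j-1}\to_C\ell_j$ or $\ell_{j-1}\to_D\ell_j$ for $1\le j\le n$, and, for $1\le j\le n-1$, if $\ell_{j-1}\not\to_D\ell_j$ then $\ell_j\to_D\ell_{j+1}$. A set $\mathbb I\subseteq\mathbb R^d$ reaches $\mathbb F\subseteq\mathbb R^d$ in $H$ if some trace goes from a state $\langle v,s\rangle$ with $s\in\mathbb I$ to a state $\langle u,r\rangle$ with $r\in\mathbb F$. **MF automata.** For $v\in\mathcal V$ and $p$ with $Inv(v)[p]$, let $F^v_p(T)=\{q : Dyn(v)[p,q,T]\wedge Inv(v)[q]\}$, and let $I^v_p\subseteq\mathbb R_{\ge0}$ be the maximal interval containing $0$ with $F^v_p(T)\ne\emptyset$ for all $T\in I^v_p$. A set $\mathbb S$ is $\alpha$-paraconvex if $\delta(q,\mathbb S)\le\alpha\epsilon$ for every ball $B(p,\epsilon)$ and every $q$ in the convex hull of $\mathbb S\cap B(p,\epsilon)$. $H$ is an MF automaton (in Michael's form) if for all such $v,p$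 the map $F^v_p$ is lower semi-continuous on $I^v_p$ and there is $\alpha\in[0,1)$ such that $F^v_p(t)$ is closed and $\alpha$-paraconvex for every $t\in I^v_p$. **Fränzle automata.** A Fränzle automaton $A$ of dimension $d$ has a finite set $\mathcal V$ of locations and formulas $act_v[Z,Z']$, $trans_{v\to v'}[Z,Z']$, $initial_v[Z]$, $safe_v[Z]$ for $v,v'\in\mathcal V$. Define $\Phi(A)^0_{v\to v'}$ as $act_v$ if $v=v'$ and as $\bot$ otherwise, and $$\Phi(A)^{i+1}_{v\to v'}[Z,Z']=\bigvee_{u\in\mathcal V}\exists Z_1\exists Z_2\bigl(\Phi(A)^i_{v\to u}[Z,Z_1]\wedge trans_{u\to v'}[Z_1,Z_2]\wedge act_{v'}[Z_2,Z']\bigr).$$ $A$ is safe if the initial states can only reach safe states: for all $i\in\mathbb N$, $v,v'\in\mathcal V$, $p,q\in\mathbb R^d$, if $initial_v[p]$ and $\Phi(A)^i_{v\to v'}[p,q]$ hold, then $safe_{v'}[q]$ holds. For an MF automaton $H$ and formulas $I[Z]$, $F[Z]$, the corresponding Fränzle automaton $Fr(H,I,F)$ has the same locations, and $$act_v=\exists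 T\bigl(T\ge0\wedge Dyn(v)[Z,Z',T]\wedge Tp(v)[Z,T]\bigr)\wedge Inv(v)[Z]\wedge Inv(v)[Z'],$$ where $Tp(v)[Z,T]=\forall T'\bigl(0\le T'\wedge T'\le T\rightarrow\exists Z'(Dyn(v)[Z,Z',T']\wedge Inv(v)[Z'])\bigr)$; moreover $trans_{v\to v'}=Act((v,v'))[Z]\wedge Res((v,v'))[Z,Z']$ if $(v,v')\in\mathcal E$ and $\bot$ otherwise; $initial_v=Inv(v)[Z]\wedge I[Z]$; and $safe_v=Inv(v)[Z]\wedge\neg F[Z]$. **Theorem.** Let $H$ be an MF automaton of dimension $d$, and let the formulas $I[Z]$ and $F[Z]$ represent $\mathbb I,\mathbb F\subseteq\mathbb R^d$. Then $\mathbb I$ reaches $\mathbb F$ in $H$ if and only if $Fr(H,I,F)$ is not safe. -/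

import Mathlib

open FirstOrder FirstOrder.Language

noncomputable section

namespace HybridReach

/-! ### First-order formulas over the reals -/

/-- The function symbols `0, 1, +, *`. -/
inductive TarskiFunc : ℕ → Type
  | zero : TarskiFunc 0
  | one : TarskiFunc 0
  | add : TarskiFunc 2
  | mul : TarskiFunc 2

/-- The relation symbol `<` (equality is a logical symbol). -/
inductive TarskiRel : ℕ → Type
  | lt : TarskiRel 2

/-- The first-order language `(0, 1, +, *, =, <)`. -/
def tarski : Language :=
  ⟨TarskiFunc, TarskiRel⟩

/-- The standard interpretation of the language over the real numbers. -/
instance tarskiReal : tarski.Structure ℝ where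
  funMap {_} f :=
    match f with
    | TarskiFunc.zero => fun _ => 0
    | TarskiFunc.one => fun _ => 1
    | TarskiFunc.add => fun x => x 0 + x 1
    | TarskiFunc.mul => fun x => x 0 * x 1
  RelMap {_} r :=
    match r with
    | TarskiRel.lt => fun x => x 0 < x 1

/-- The formulas whose free variables are indexed by `X`. -/
abbrev Fml (X : Type) : Type := tarski.Formula X

/-- `0` as a symbol of the language. -/
def zeroSymb : tarski.Functions 0 := TarskiFunc.zero

/-- `<` as a symbol of the language. -/
def ltSymb : tarski.Relations 2 := TarskiRel.lt

/-- The term `0`. -/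
def zeroTerm {X : Type} : tarski.Term X :=
  Term.func zeroSymb Fin.elim0

/-- The atomic formula `s < t`. -/
def ltFml {X : Type} (s t : tarski.Term X) : Fml X :=
  Relations.formula₂ ltSymb s t

/-- The formula `s ≤ t`, that is `s < t ∨ s = t`. -/
def leFml {X : Type} (s t : tarski.Term X) : Fml X :=
  ltFml s t ⊔ Term.equal s t

/-- The Euclidean space `ℝ^d`. -/
abbrev Pt (d : ℕ) : Type := EuclideanSpace ℝ (Fin d)

/-- Index type for the variables `Z` (left summand) and `Z'` (right summand). -/
abbrev ZZ (d : ℕ) : Type := Fin d ⊕ Fin d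

/-- Index type for the variables `Z`, `Z'` and `T` (the last summand). -/
abbrev ZZT (d : ℕ) : Type := ZZ d ⊕ Unit

/-- `φ[p]` holds. -/
def Holds₁ {d : ℕ} (φ : Fml (Fin d)) (p : Pt d) : Prop :=
  φ.Realize (fun i => p i)

/-- `φ[p, q]` holds. -/
def Holds₂ {d : ℕ} (φ : Fml (ZZ d)) (p q : Pt d) : Prop :=
  φ.Realize (Sum.elim (fun i => p i) (fun i => q i))

/-- `φ[p, q, t]` holds. -/
def Holds₃ {d : ℕ} (φ : Fml (ZZT d)) (p q : Pt d) (t : ℝ) : Prop :=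
  φ.Realize (Sum.elim (Sum.elim (fun i => p i) (fun i => q i)) (fun _ => t))

/-- The formula `φ[Z]` represents the set `S`. -/
def Represents {d : ℕ} (φ : Fml (Fin d)) (S : Set (Pt d)) : Prop :=
  {p | Holds₁ φ p} = S

/-! ### Hybrid automata -/

/-- A hybrid automaton of dimension `d` whose set of locations is `V`. -/
structure HybridAutomaton (V : Type*) (d : ℕ) where
  edges : Set (V × V)
  inv : V → Fml (Fin d)
  dyn : V → Fml (ZZT d)
  act : edges → Fml (Fin d)
  res : edges → Fml (ZZ d)
  dyn_zero : ∀ v p, Holds₁ (inv v) p → ∀ q, Holds₃ (dyn v) p q 0 ↔ p = q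

namespace HybridAutomaton

variable {V : Type*} {d : ℕ} (H : HybridAutomaton V d)

/-- The state `⟨v, s⟩` is admissible. -/
def Admissible (l : V × Pt d) : Prop :=
  Holds₁ (H.inv l.1) l.2

/-- The continuous transition relation: a continuous flow which at every time satisfies
the invariant and the dynamics of the location. -/
def ContStep (l l' : V × Pt d) : Prop :=
  l.1 = l'.1 ∧
    ∃ f : NNReal → Pt d, Continuous f ∧ l.2 = f 0 ∧
      ∃ t : NNReal, l'.2 = f t ∧
        ∀ t' ∈ Set.Icc 0 t, Holds₁ (H.inv l.1) (f t') ∧ Holds₃ (H.dyn l.1) l.2 (f t') t'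

/-- The discrete transition relation. -/
def DiscStep (l l' : V × Pt d) : Prop :=
  ∃ e : H.edges, e.1 = (l.1, l'.1) ∧ Holds₁ (H.act e) l.2 ∧ Holds₂ (H.res e) l.2 l'.2

/-- `ℓ 0, …, ℓ n` is a trace of length `n` (the values `ℓ j` with `j > n` play no role). -/
def IsTrace (n : ℕ) (l : ℕ → V × Pt d) : Prop :=
  0 < n ∧
    (∀ j ≤ n, H.Admissible (l j)) ∧
    (∀ j ∈ Set.Icc 1 n, H.ContStep (l (j - 1)) (l j) ∨ H.DiscStep (l (j - 1)) (l j)) ∧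
    (∀ j ∈ Set.Icc 1 (n - 1),
      ¬ H.DiscStep (l (j - 1)) (l j) → H.DiscStep (l j) (l (j + 1)))

/-- The point `s` reaches the point `r`. -/
def PointReaches (s r : Pt d) : Prop :=
  ∃ n l, H.IsTrace n l ∧ (l 0).2 = s ∧ (l n).2 = r

/-- The set `I` reaches the set `F`. -/
def SetReaches (I F : Set (Pt d)) : Prop :=
  ∃ s ∈ I, ∃ r ∈ F, H.PointReaches s r

/-! ### Michael's form -/

/-- The set-valued map `F^v_p`. -/
def flowSet (v : V) (p : Pt d) (T : ℝ) : Set (Pt d) :=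
  {q | Holds₃ (H.dyn v) p q T ∧ Holds₁ (H.inv v) q}

/-- The interval `I^v_p`: the largest interval of times `T ≥ 0` which contains `0` and on which
`F^v_p` has nonempty values (see `timeDomain_isGreatest`). -/
def timeDomain (v : V) (p : Pt d) : Set ℝ :=
  {T | 0 ≤ T ∧ ∀ T' ∈ Set.Icc 0 T, (H.flowSet v p T').Nonempty}

theorem timeDomain_isGreatest (v : V) (p : Pt d) (hp : Holds₁ (H.inv v) p) :
    IsGreatest {J : Set ℝ | J.OrdConnected ∧ J ⊆ Set.Ici 0 ∧ (0 : ℝ) ∈ J ∧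
      ∀ T ∈ J, (H.flowSet v p T).Nonempty} (H.timeDomain v p) := by
  refine ⟨⟨⟨?_⟩, fun T hT => hT.1, ⟨le_rfl, ?_⟩, fun T hT => hT.2 T ⟨hT.1, le_rfl⟩⟩, ?_⟩
  · rintro x hx y hy z ⟨hxz, hzy⟩
    exact ⟨hx.1.trans hxz, fun T' hT' => hy.2 T' ⟨hT'.1, hT'.2.trans hzy⟩⟩
  · intro T' hT'
    obtain rfl : T' = 0 := le_antisymm hT'.2 hT'.1
    exact ⟨p, (H.dyn_zero v p hp p).2 rfl, hp⟩
  · rintro J ⟨hJ, hpos, h0, hne⟩ T hT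
    exact ⟨hpos hT, fun T' hT' => hne T' (hJ.out h0 hT hT')⟩

end HybridAutomaton

/-- `S` is `α`-paraconvex. -/
def IsParaconvex {d : ℕ} (α : ℝ) (S : Set (Pt d)) : Prop :=
  ∀ (p : Pt d) (ε : ℝ), 0 < ε →
    ∀ q ∈ convexHull ℝ (S ∩ Metric.ball p ε), Metric.infDist q S ≤ α * ε

namespace HybridAutomaton

variable {V : Type*} {d : ℕ} (H : HybridAutomaton V d)

/-- `H` is in Michael's form: every map `F^v_p` on `I^v_p` satisfies the hypotheses of Michael's
selection theorem, with a constant `α < 1` that does not depend on the time. -/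
def IsMF : Prop :=
  ∀ v p, Holds₁ (H.inv v) p →
    LowerHemicontinuousOn (H.flowSet v p) (H.timeDomain v p) ∧
    ∃ α : ℝ, 0 ≤ α ∧ α < 1 ∧
      ∀ t ∈ H.timeDomain v p,
        IsClosed (H.flowSet v p t) ∧ IsParaconvex α (H.flowSet v p t)

/-! ### The formula for continuous reachability -/

/-- `Tp(v)[Z, T]`, that is
`∀ T' (0 ≤ T' ∧ T' ≤ T → ∃ Z' (Dyn(v)[Z, Z', T'] ∧ Inv(v)[Z']))`. -/
def tp (v : V) : Fml (Fin d ⊕ Unit) :=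
  let T' : (Fin d ⊕ Unit) ⊕ Unit := Sum.inr ()
  let T : (Fin d ⊕ Unit) ⊕ Unit := Sum.inl (Sum.inr ())
  let dyn' : Fml (((Fin d ⊕ Unit) ⊕ Unit) ⊕ Fin d) :=
    (H.dyn v).relabel
      (Sum.elim (Sum.elim (fun i => Sum.inl (Sum.inl (Sum.inl i))) Sum.inr)
        (fun _ => Sum.inl T'))
  let inv' : Fml (((Fin d ⊕ Unit) ⊕ Unit) ⊕ Fin d) := (H.inv v).relabel Sum.inr
  Formula.iAlls Unit
    ((leFml zeroTerm (Term.var T') ⊓ leFml (Term.var T') (Term.var T)).imp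
      (Formula.iExs (Fin d) (dyn' ⊓ inv')))

/-- `Reach⁰(v, v)[Z, Z']`, that is
`∃ T (T ≥ 0 ∧ Dyn(v)[Z, Z', T] ∧ Tp(v)[Z, T]) ∧ Inv(v)[Z] ∧ Inv(v)[Z']`. -/
def reachZero (v : V) : Fml (ZZ d) :=
  let T : ZZT d := Sum.inr ()
  let tp' : Fml (ZZT d) := (H.tp v).relabel (Sum.elim (fun i => Sum.inl (Sum.inl i)) (fun _ => T))
  Formula.iExs Unit (leFml zeroTerm (Term.var T) ⊓ H.dyn v ⊓ tp') ⊓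
    (H.inv v).relabel Sum.inl ⊓ (H.inv v).relabel Sum.inr

end HybridAutomaton

/-! ### Fränzle automata -/

/-- A Fränzle hybrid automaton of dimension `d` whose set of locations is `V`. -/
structure FranzleAutomaton (V : Type*) (d : ℕ) where
  act : V → Fml (ZZ d)
  trans : V → V → Fml (ZZ d)
  initial : V → Fml (Fin d)
  safe : V → Fml (Fin d)

namespace FranzleAutomaton

variable {V : Type*} [Finite V] {d : ℕ} (A : FranzleAutomaton V d)

open Classical in
/-- The formula `Φ(A)^i_{v → v'}[Z, Z']`. In the inductive step it is
`⋁_u ∃ Z₁ ∃ Z₂ (Φ(A)^i_{v → u}[Z, Z₁] ∧ trans_{u → v'}[Z₁, Z₂] ∧ act_{v'}[Z₂, Z'])`;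
there the variables `Z, Z'` are in the left summand and `Z₁, Z₂` in the right one. -/
def reachFml : ℕ → V → V → Fml (ZZ d)
  | 0, v, v' => if v = v' then A.act v else ⊥
  | i + 1, v, v' =>
      let z : Fin d → ZZ d ⊕ ZZ d := fun k => Sum.inl (Sum.inl k)
      let z' : Fin d → ZZ d ⊕ ZZ d := fun k => Sum.inl (Sum.inr k)
      let z₁ : Fin d → ZZ d ⊕ ZZ d := fun k => Sum.inr (Sum.inl k)
      let z₂ : Fin d → ZZ d ⊕ ZZ d := fun k => Sum.inr (Sum.inr k)
      Formula.iSup fun u : V =>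
        Formula.iExs (ZZ d)
          ((reachFml i v u).relabel (Sum.elim z z₁) ⊓
            (A.trans u v').relabel (Sum.elim z₁ z₂) ⊓
            (A.act v').relabel (Sum.elim z₂ z'))

/-- The automaton is safe: the initial states can only reach safe states. -/
def IsSafe : Prop :=
  ∀ (i : ℕ) (v v' : V) (p q : Pt d),
    Holds₁ (A.initial v) p → Holds₂ (A.reachFml i v v') p q → Holds₁ (A.safe v') q

end FranzleAutomaton

open Classical in
/-- The Fränzle automaton `Fr(H, I, F)` corresponding to `H`, `I[Z]` and `F[Z]`. -/
def HybridAutomaton.franzle {V : Type*} {d : ℕ} (H : HybridAutomaton V d) (I F : Fml (Fin d)) :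
    FranzleAutomaton V d where
  act v := H.reachZero v
  trans v v' :=
    if h : (v, v') ∈ H.edges then (H.act ⟨(v, v'), h⟩).relabel Sum.inl ⊓ H.res ⟨(v, v'), h⟩ else ⊥
  initial v := H.inv v ⊓ I
  safe v := H.inv v ⊓ ∼F

end HybridReach

end

/-! The two automata differ in how they describe continuous motion: `ContStep` asks for a continuous
flow, `reachZero` only for nonempty sets `F^v_p(T')` at all times up to `T`, with the target in
`F^v_p(T)`. A flow provides such points at once. Conversely, a flow from `p` to `q` is a continuous
selection of `F^v_p` on `[0, T]` ending at `q`. Replacing the last value by `{q}` keeps the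
hypotheses of Michael's theorem, so `exists_continuous_selection` provides one; `dyn_zero` forces it
to start at `p`. Hence `reachZero` expresses `ContStep` (`IsMF.contStep`).

The selection is a uniform limit: paraconvexity lets an approximate selection with error `r` be
replaced by one with error `γ * r`, where `γ < 1`.

What remains is combinatorial: `Φ(A)^i` describes strictly alternating runs, and a trace becomes one
by inserting flows of duration zero. -/

open Set Metric Filter Topology

/-! ### Michael selection for paraconvex values -/

section Selection

variable {X : Type*} [TopologicalSpace X] [CompactSpace X] [T2Space X] {d : ℕ}

/-- A nearby continuous function which is closer to a lower hemicontinuous family of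
`α`-paraconvex sets. -/
theorem HybridReach.exists_continuous_infDist_lt {F : X → Set (HybridReach.Pt d)}
    (hF : LowerHemicontinuous F) (hne : ∀ x, (F x).Nonempty) {α : ℝ}
    (hα : ∀ x, HybridReach.IsParaconvex α (F x)) {r δ : ℝ} (hr : 0 < r) (hδ : 0 < δ)
    (g : C(X, HybridReach.Pt d)) (hg : ∀ x, infDist (g x) (F x) < r) :
    ∃ h : C(X, HybridReach.Pt d),
      ∀ x, infDist (h x) (F x) < α * r + δ ∧ dist (g x) (h x) < r + δ := by
  -- Thickening the hull lets one constant serve for all nearby `x`; a partition of unity then glues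
  -- these constants inside convex sets.
  obtain ⟨h, hh⟩ := exists_continuous_forall_mem_convex_of_local_const
    (t := fun x => thickening δ (convexHull ℝ (F x ∩ ball (g x) r)))
    (fun x => (convex_convexHull ℝ _).thickening δ) (fun x => by
      obtain ⟨y, hy, hyr⟩ := (infDist_lt_iff (hne x)).1 (hg x)
      refine ⟨y, ?_⟩
      -- The slack `r - ρ` pays for moving from `y` to a nearby `z ∈ F x'` without leaving the ball
      -- of radius `r` about `g x'`.
      obtain ⟨ρ, hρ, hρr⟩ := exists_between hyr
      have hgρ : ∀ᶠ x' in 𝓝 x, dist (g x') y < ρ :=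
        (g.continuous.dist continuous_const).continuousAt.eventually_lt continuousAt_const hρ
      have hm : 0 < min δ (r - ρ) := lt_min hδ (sub_pos.2 hρr)
      have hFy := lowerHemicontinuousAt_iff.1 (hF.lowerHemicontinuousAt x)
        (ball y (min δ (r - ρ))) isOpen_ball ⟨y, hy, mem_ball_self hm⟩
      filter_upwards [hgρ, hFy] with x' hx' hz
      obtain ⟨z, hz, hzy⟩ := hz
      rw [mem_ball, lt_min_iff] at hzy
      refine mem_thickening_iff.2 ⟨z, subset_convexHull ℝ _ ⟨hz, ?_⟩, ?_⟩
      · rw [mem_ball]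
        have := dist_triangle z y (g x')
        rw [dist_comm y] at this
        linarith [hzy.2]
      · rw [dist_comm]
        exact hzy.1)
  refine ⟨h, fun x => ?_⟩
  obtain ⟨z, hz, hzd⟩ := mem_thickening_iff.1 (hh x)
  -- Paraconvexity on this ball costs `α * r`; the thickening adds `δ`.
  have hzα := hα x (g x) r hr z hz
  have hzb : z ∈ ball (g x) r :=
    convexHull_min inter_subset_right (convex_ball _ _) hz
  constructor
  · have := infDist_le_infDist_add_dist (x := h x) (y := z) (s := F x)
    linarith
  · have := dist_triangle (g x) z (h x)
    rw [mem_ball, dist_comm] at hzb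
    rw [dist_comm] at hzd
    linarith

/-- Michael's selection theorem for closed paraconvex values over a compact space. -/
theorem HybridReach.exists_continuous_selection {F : X → Set (HybridReach.Pt d)}
    (hF : LowerHemicontinuous F) (hne : ∀ x, (F x).Nonempty) (hcl : ∀ x, IsClosed (F x))
    {α : ℝ} (hα0 : 0 ≤ α) (hα1 : α < 1) (hα : ∀ x, HybridReach.IsParaconvex α (F x)) :
    ∃ f : C(X, HybridReach.Pt d), ∀ x, f x ∈ F x := by
  obtain ⟨γ, hαγ, hγ1⟩ := exists_between hα1
  have hγ0 : 0 < γ := hα0.trans_lt hαγ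
  -- The zero map starts the iteration: lower hemicontinuity bounds its error locally, compactness
  -- globally.
  obtain ⟨R, hR0, hR⟩ : ∃ R : ℝ, 0 < R ∧ ∀ x, infDist (0 : HybridReach.Pt d) (F x) < R := by
    have hloc : ∀ x ∈ (univ : Set X), ∃ t ∈ 𝓝[univ] x, ∃ R : ℝ, 0 < R ∧
        ∀ y ∈ t, infDist (0 : HybridReach.Pt d) (F y) < R := by
      intro x _
      obtain ⟨z, hz⟩ := hne x
      have hR : 0 < ‖z‖ + 1 := by positivity
      have := lowerHemicontinuousAt_iff.1 (hF.lowerHemicontinuousAt x)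
        (ball 0 (‖z‖ + 1)) isOpen_ball ⟨z, hz, by simp⟩
      rw [nhdsWithin_univ]
      refine ⟨_, this, ‖z‖ + 1, hR, ?_⟩
      rintro y ⟨w, hw, hwR⟩
      exact (infDist_le_dist_of_mem hw).trans_lt (by rwa [dist_comm])
    obtain ⟨R, hR0, hR⟩ := isCompact_univ.induction_on
      (p := fun t : Set X => ∃ R : ℝ, 0 < R ∧
        ∀ y ∈ t, infDist (0 : HybridReach.Pt d) (F y) < R)
      ⟨1, one_pos, by simp⟩
      (fun s t hst ⟨R, h0, h⟩ => ⟨R, h0, fun y hy => h y (hst hy)⟩)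
      (fun s t ⟨R, h0, h⟩ ⟨R', _, h'⟩ => ⟨max R R', lt_max_of_lt_left h0, fun y hy =>
        hy.elim (fun hy => lt_max_of_lt_left (h y hy)) (fun hy => lt_max_of_lt_right (h' y hy))⟩)
      hloc
    exact ⟨R, hR0, fun x => hR x (mem_univ x)⟩
  have hstep : ∀ (n : ℕ) (g : C(X, HybridReach.Pt d)), ∃ h : C(X, HybridReach.Pt d),
      (∀ x, infDist (g x) (F x) < R * γ ^ n) →
        ∀ x, infDist (h x) (F x) < R * γ ^ (n + 1) ∧ dist (g x) (h x) < 2 * R * γ ^ n := by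
    intro n g
    by_cases hg : ∀ x, infDist (g x) (F x) < R * γ ^ n
    · have hr : 0 < R * γ ^ n := by positivity
      -- With `r = R * γ ^ n` and `δ = (γ - α) * r`, the new error `α * r + δ` is exactly `γ * r`,
      -- and the move `r + δ` is at most `2 * r`.
      obtain ⟨h, hh⟩ := HybridReach.exists_continuous_infDist_lt hF hne hα hr
        (mul_pos (sub_pos.2 hαγ) hr) g hg
      refine ⟨h, fun _ x => ⟨(hh x).1.trans_eq (by ring), (hh x).2.trans_le ?_⟩⟩
      nlinarith
    · exact ⟨g, fun h => absurd h hg⟩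
  choose next hnext using hstep
  let u : ℕ → C(X, HybridReach.Pt d) := fun n => Nat.rec 0 next n
  have hu : ∀ n x, infDist (u n x) (F x) < R * γ ^ n := by
    intro n
    induction n with
    | zero => simpa [u] using hR
    | succ n ih => exact fun x => (hnext n (u n) ih x).1
  have hdist : ∀ n, dist (u n) (u (n + 1)) ≤ 2 * R * γ ^ n := fun n =>
    (ContinuousMap.dist_le (by positivity)).2 fun x => (hnext n (u n) (hu n) x).2.le
  obtain ⟨f, hf⟩ := cauchySeq_tendsto_of_complete (cauchySeq_of_le_geometric γ _ hγ1 hdist)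
  refine ⟨f, fun x => ((hcl x).mem_iff_infDist_zero (hne x)).2 (le_antisymm ?_ infDist_nonneg)⟩
  have h1 : Tendsto (fun n => infDist (u n x) (F x)) atTop (𝓝 (infDist (f x) (F x))) :=
    ((continuous_infDist_pt (F x)).tendsto _).comp
      (((ContinuousEvalConst.continuous_eval_const x).tendsto f).comp hf)
  have h2 : Tendsto (fun n => R * γ ^ n) atTop (𝓝 0) := by
    simpa using (tendsto_pow_atTop_nhds_zero_of_lt_one hγ0.le hγ1).const_mul R
  exact le_of_tendsto_of_tendsto' h1 h2 fun n => (hu n x).le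

end Selection

namespace HybridReach

/-! ### Prescribing one value of the set-valued map -/

theorem isParaconvex_singleton {d : ℕ} {α : ℝ} (hα : 0 ≤ α) (q : Pt d) :
    IsParaconvex α {q} := by
  intro p ε hε z hz
  have : z ∈ ({q} : Set (Pt d)) := convexHull_min inter_subset_left (convex_singleton q) hz
  rw [infDist_zero_of_mem this]
  positivity

/-- Prescribing the value of a lower hemicontinuous map at one point. -/
theorem lowerHemicontinuous_piecewise_singleton {X E : Type*} [TopologicalSpace X] [T1Space X]
    [TopologicalSpace E] {F : X → Set E} (hF : LowerHemicontinuous F) (x₀ : X) {q : E}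
    (hq : q ∈ F x₀) {G : X → Set E} (h₀ : G x₀ = {q}) (hG : ∀ x ≠ x₀, G x = F x) :
    LowerHemicontinuous G := by
  intro x
  rw [← LowerHemicontinuousAt, lowerHemicontinuousAt_iff]
  intro U hU hne
  by_cases hx : x = x₀
  · subst hx
    have hqU : q ∈ U := by
      obtain ⟨z, hz, hzU⟩ := hne
      rw [h₀] at hz
      exact hz ▸ hzU
    filter_upwards [lowerHemicontinuousAt_iff.1 (hF.lowerHemicontinuousAt x) U hU ⟨q, hq, hqU⟩]
      with y hy
    by_cases hyx : y = x
    · subst hyx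
      exact ⟨q, by simp [h₀], hqU⟩
    · rwa [hG y hyx]
  · rw [hG x hx] at hne
    filter_upwards [lowerHemicontinuousAt_iff.1 (hF.lowerHemicontinuousAt x) U hU hne,
      isOpen_ne.mem_nhds hx] with y hy hyx
    rwa [hG y hyx]

/-! ### Semantics of the formulas -/

theorem realize_leFml {X : Type} (s t : tarski.Term X) (v : X → ℝ) :
    (leFml s t).Realize v ↔ s.realize v ≤ t.realize v := by
  rw [leFml, ltFml, Formula.realize_sup, Formula.realize_rel₂, Formula.realize_equal,
    le_iff_lt_or_eq]
  rfl

theorem realize_zeroTerm {X : Type} (v : X → ℝ) : (zeroTerm : tarski.Term X).realize v = 0 := rfl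

theorem holds₂_relabel_inl {d : ℕ} (φ : Fml (Fin d)) (p q : Pt d) :
    Holds₂ (φ.relabel Sum.inl) p q ↔ Holds₁ φ p := by
  rw [Holds₂, Formula.realize_relabel]
  rfl

namespace HybridAutomaton

variable {V : Type*} {d : ℕ} (H : HybridAutomaton V d)

theorem realize_tp (v : V) (p : Pt d) (T : ℝ) :
    (H.tp v).Realize (Sum.elim (fun i => p i) (fun _ => T)) ↔
      ∀ T' ∈ Icc 0 T, (H.flowSet v p T').Nonempty := by
  have key : ∀ (w : Unit → ℝ) (z : Fin d → ℝ),
      (Sum.elim (Sum.elim (Sum.elim (fun i => p i) (fun _ : Unit => T)) w) z ∘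
        (Sum.elim (Sum.elim (fun i => Sum.inl (Sum.inl (Sum.inl i))) Sum.inr)
          (fun _ => Sum.inl (Sum.inr ()))) : ZZT d → ℝ) =
      Sum.elim (Sum.elim (fun i => p i) z) (fun _ => w ()) := by
    intro w z
    funext x
    rcases x with (x | x) | x <;> rfl
  simp only [tp, Formula.realize_iAlls, Formula.realize_imp, Formula.realize_inf, realize_leFml,
    realize_zeroTerm, Term.realize_var, Formula.realize_iExs, Formula.realize_relabel, key,
    Sum.elim_inr, Sum.elim_inl, Sum.elim_comp_inr]
  constructor
  · intro h T' hT'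
    obtain ⟨z, hz⟩ := h (fun _ => T') hT'
    exact ⟨WithLp.toLp 2 z, hz⟩
  · intro h w hw
    obtain ⟨z, hz⟩ := h (w ()) hw
    exact ⟨fun i => z i, hz⟩

/-- The conjunct `Tp` places `T` in `timeDomain`, where the hypotheses of Michael's form are
available. -/
theorem holds₂_reachZero (v : V) (p q : Pt d) :
    Holds₂ (H.reachZero v) p q ↔
      (∃ T ∈ H.timeDomain v p, q ∈ H.flowSet v p T) ∧ Holds₁ (H.inv v) p := by
  have key : ∀ w : Unit → ℝ,
      (Sum.elim (Sum.elim (fun i => p i) (fun i => q i)) w ∘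
        (Sum.elim (fun i => Sum.inl (Sum.inl i)) (fun _ => Sum.inr ())) : Fin d ⊕ Unit → ℝ) =
      Sum.elim (fun i => p i) (fun _ => w ()) := by
    intro w
    funext x
    rcases x with x | x <;> rfl
  have h1 : Holds₂ (H.reachZero v) p q ↔
      ((∃ w : Unit → ℝ, (0 ≤ w () ∧ Holds₃ (H.dyn v) p q (w ())) ∧
        ∀ T' ∈ Icc 0 (w ()), (H.flowSet v p T').Nonempty) ∧ Holds₁ (H.inv v) p) ∧
        Holds₁ (H.inv v) q := by
    simp only [Holds₂, reachZero, Formula.realize_inf, Formula.realize_iExs, realize_leFml,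
      realize_zeroTerm, Term.realize_var, Formula.realize_relabel, key, realize_tp,
      Sum.elim_inr, Sum.elim_comp_inl, Sum.elim_comp_inr]
    rfl
  rw [h1]
  constructor
  · rintro ⟨⟨⟨w, ⟨h0, hd⟩, ht⟩, hp⟩, hq⟩
    exact ⟨⟨w (), ⟨h0, ht⟩, hd, hq⟩, hp⟩
  · rintro ⟨⟨T, ⟨h0, ht⟩, hd, hq⟩, hp⟩
    exact ⟨⟨⟨fun _ => T, ⟨h0, hd⟩, ht⟩, hp⟩, hq⟩

theorem holds₂_franzle_trans (I F : Fml (Fin d)) (v v' : V) (p q : Pt d) :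
    Holds₂ ((H.franzle I F).trans v v') p q ↔ H.DiscStep (v, p) (v', q) := by
  by_cases h : (v, v') ∈ H.edges
  · simp only [franzle, h, dif_pos]
    rw [Holds₂, Formula.realize_inf, ← Holds₂, ← Holds₂, holds₂_relabel_inl]
    constructor
    · rintro ⟨h1, h2⟩
      exact ⟨⟨(v, v'), h⟩, rfl, h1, h2⟩
    · rintro ⟨⟨e, he⟩, rfl, h1, h2⟩
      exact ⟨h1, h2⟩
  · simp only [franzle, h, dif_neg, not_false_eq_true]
    constructor
    · intro h'
      exact absurd h' (by simp [Holds₂, Formula.Realize])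
    · rintro ⟨⟨e, he⟩, rfl, -⟩
      exact absurd he h

end HybridAutomaton

theorem FranzleAutomaton.holds₂_reachFml_zero {V : Type*} [Finite V] {d : ℕ}
    (A : FranzleAutomaton V d) (v v' : V) (p q : Pt d) :
    Holds₂ (A.reachFml 0 v v') p q ↔ v = v' ∧ Holds₂ (A.act v) p q := by
  by_cases h : v = v'
  · simp [reachFml, h]
  · simp [reachFml, h, Holds₂, Formula.Realize]

theorem FranzleAutomaton.holds₂_reachFml_succ {V : Type*} [Finite V] {d : ℕ}
    (A : FranzleAutomaton V d) (i : ℕ) (v v' : V) (p q : Pt d) :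
    Holds₂ (A.reachFml (i + 1) v v') p q ↔ ∃ (u : V) (r s : Pt d),
      Holds₂ (A.reachFml i v u) p r ∧ Holds₂ (A.trans u v') r s ∧ Holds₂ (A.act v') s q := by
  have key : ∀ (w : ZZ d → ℝ) (f g : Fin d → ZZ d ⊕ ZZ d),
      Sum.elim (Sum.elim (fun i => p i) (fun i => q i)) w ∘ Sum.elim f g =
        Sum.elim (fun k => Sum.elim (Sum.elim (fun i => p i) (fun i => q i)) w (f k))
          (fun k => Sum.elim (Sum.elim (fun i => p i) (fun i => q i)) w (g k)) := by
    intro w f g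
    funext x
    rcases x with x | x <;> rfl
  simp only [Holds₂, reachFml, Formula.realize_iSup, Formula.realize_iExs, Formula.realize_inf,
    Formula.realize_relabel, key, Sum.elim_inl, Sum.elim_inr]
  constructor
  · rintro ⟨u, w, ⟨h1, h2⟩, h3⟩
    exact ⟨u, WithLp.toLp 2 fun k => w (Sum.inl k), WithLp.toLp 2 fun k => w (Sum.inr k),
      h1, h2, h3⟩
  · rintro ⟨u, r, s, h1, h2, h3⟩
    exact ⟨u, Sum.elim (fun k => r k) (fun k => s k), ⟨h1, h2⟩, h3⟩

namespace HybridAutomaton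

variable {V : Type*} {d : ℕ} (H : HybridAutomaton V d)

/-! ### Continuous steps -/

theorem holds₂_reachZero_of_contStep {v v' : V} {p q : Pt d} (h : H.ContStep (v, p) (v', q)) :
    v = v' ∧ Holds₂ (H.reachZero v) p q := by
  obtain ⟨hv, f, -, h0, t, ht, hf⟩ := h
  dsimp only at hv h0 ht hf
  refine ⟨hv, (H.holds₂_reachZero v p q).2 ⟨⟨t, ⟨t.2, fun T' hT' => ?_⟩, ?_⟩, ?_⟩⟩
  · obtain ⟨h1, h2⟩ := hf ⟨T', hT'.1⟩ ⟨zero_le, hT'.2⟩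
    exact ⟨f ⟨T', hT'.1⟩, h2, h1⟩
  · obtain ⟨h1, h2⟩ := hf t ⟨zero_le, le_rfl⟩
    rw [ht]
    exact ⟨h2, h1⟩
  · rw [h0]
    exact (hf 0 ⟨le_rfl, zero_le⟩).1

theorem holds₂_reachZero_self {v : V} {p : Pt d} (hp : Holds₁ (H.inv v) p) :
    Holds₂ (H.reachZero v) p p := by
  refine (H.holds₂_reachZero v p p).2 ⟨⟨0, ?_, (H.dyn_zero v p hp p).2 rfl, hp⟩, hp⟩
  exact (H.timeDomain_isGreatest v p hp).1.2.2.1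

/-- This is where Michael's form enters: the flow is a selection on the compact interval `[0, T]`.
-/
theorem IsMF.contStep {H : HybridAutomaton V d} (hH : H.IsMF) {v : V} {p q : Pt d}
    (h : Holds₂ (H.reachZero v) p q) : H.ContStep (v, p) (v, q) := by
  obtain ⟨⟨T, hT, hq⟩, hp⟩ := (H.holds₂_reachZero v p q).1 h
  obtain ⟨hlsc, α, hα0, hα1, hα⟩ := hH v p hp
  have hT0 : 0 ≤ T := hT.1
  have hsub : Icc 0 T ⊆ H.timeDomain v p := fun t ht =>
    (H.timeDomain_isGreatest v p hp).1.1.out (H.timeDomain_isGreatest v p hp).1.2.2.1 hT ht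
  -- Only the endpoint `T` needs pinning; the value at time `0` is already `{p}`.
  let G : Icc 0 T → Set (Pt d) := fun t => {z | z ∈ H.flowSet v p t ∧ ((t : ℝ) = T → z = q)}
  let xT : Icc 0 T := ⟨T, hT0, le_rfl⟩
  have hGT : G xT = {q} := by
    ext z
    simp only [G, xT, mem_ofPred_eq, mem_singleton_iff, forall_const]
    exact ⟨fun h => h.2, fun h => ⟨h ▸ hq, h⟩⟩
  have hG : ∀ x ≠ xT, G x = H.flowSet v p x := by
    intro x hx
    ext z
    simp only [G, mem_ofPred_eq, and_iff_left_iff_imp]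
    exact fun _ h => absurd (Subtype.ext h) hx
  have hGlsc : LowerHemicontinuous G :=
    lowerHemicontinuous_piecewise_singleton
      (lowerHemicontinuous_restrict_iff.2 (hlsc.mono hsub)) xT hq hGT hG
  have hprop : ∀ x, (G x).Nonempty ∧ IsClosed (G x) ∧ IsParaconvex α (G x) := by
    intro x
    by_cases hx : x = xT
    · rw [hx, hGT]
      exact ⟨singleton_nonempty q, isClosed_singleton, isParaconvex_singleton hα0 q⟩
    · rw [hG x hx]
      exact ⟨hT.2 x x.2, hα x (hsub x.2)⟩
  obtain ⟨f, hf⟩ := exists_continuous_selection hGlsc (fun x => (hprop x).1)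
    (fun x => (hprop x).2.1) hα0 hα1 (fun x => (hprop x).2.2)
  have hproj : ∀ t (ht : t ∈ Icc 0 T), projIcc 0 T hT0 t = ⟨t, ht⟩ := fun t ht =>
    projIcc_of_mem hT0 ht
  -- Projection onto `[0, T]` extends the selection to all times, constant after `T`.
  refine ⟨rfl, fun t => f (projIcc 0 T hT0 t),
    f.continuous.comp (continuous_projIcc.comp NNReal.continuous_coe), ?_, Real.toNNReal T, ?_, ?_⟩
  · have h0 := hf ⟨0, le_rfl, hT0⟩
    dsimp only
    rw [NNReal.coe_zero, hproj 0 ⟨le_rfl, hT0⟩]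
    exact (H.dyn_zero v p hp _).1 h0.1.1
  · dsimp only
    rw [Real.coe_toNNReal T hT0, hproj T ⟨hT0, le_rfl⟩]
    exact ((hf xT).2 rfl).symm
  · intro t ht
    have ht' : (t : ℝ) ∈ Icc 0 T := ⟨t.2, (NNReal.coe_le_coe.2 ht.2).trans_eq (Real.coe_toNNReal T hT0)⟩
    dsimp only
    rw [hproj t ht']
    exact ⟨(hf ⟨t, ht'⟩).1.2, (hf ⟨t, ht'⟩).1.1⟩

/-! ### Traces -/

/-- Each round of `Φ` is a jump followed by a flow. A lone jump is completed by a flow of duration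
zero; a flow is paired with the jump before it, which moves the induction back by two states. -/
theorem IsTrace.exists_holds₂_reachFml [Finite V] {H : HybridAutomaton V d} {n : ℕ}
    {l : ℕ → V × Pt d} (hl : H.IsTrace n l) (I F : Fml (Fin d)) (m : ℕ) (hm : m ≤ n) :
    ∃ i, Holds₂ ((H.franzle I F).reachFml i (l 0).1 (l m).1) (l 0).2 (l m).2 := by
  obtain ⟨-, hadm, hstep, halt⟩ := hl
  have hdisc : ∀ {i k : ℕ} {v : V} {q : Pt d},
      Holds₂ ((H.franzle I F).reachFml i (l 0).1 (l k).1) (l 0).2 (l k).2 →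
      H.DiscStep (l k) (l (k + 1)) → Holds₂ (H.reachZero (l (k + 1)).1) (l (k + 1)).2 q →
      v = (l (k + 1)).1 →
      Holds₂ ((H.franzle I F).reachFml (i + 1) (l 0).1 v) (l 0).2 q := by
    intro i k v q h1 h2 h3 hv
    subst hv
    exact (FranzleAutomaton.holds₂_reachFml_succ _ _ _ _ _ _).2
      ⟨_, _, _, h1, (H.holds₂_franzle_trans I F _ _ _ _).2 h2, h3⟩
  induction m using Nat.strong_induction_on with
  | _ m ih =>
    rcases m with _ | k
    · exact ⟨0, (FranzleAutomaton.holds₂_reachFml_zero _ _ _ _ _).2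
        ⟨rfl, H.holds₂_reachZero_self (hadm 0 hm)⟩⟩
    by_cases hd : H.DiscStep (l k) (l (k + 1))
    · obtain ⟨i, hi⟩ := ih k (by omega) (by omega)
      exact ⟨i + 1, hdisc hi hd (H.holds₂_reachZero_self (hadm (k + 1) hm)) rfl⟩
    · have hc : H.ContStep (l k) (l (k + 1)) :=
        (hstep (k + 1) ⟨by omega, hm⟩).resolve_right hd
      obtain ⟨hv, hr⟩ := H.holds₂_reachZero_of_contStep hc
      rcases k with _ | k
      · exact ⟨0, (FranzleAutomaton.holds₂_reachFml_zero _ _ _ _ _).2 ⟨hv, hr⟩⟩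
      -- Two consecutive steps that are not discrete would violate the trace condition.
      · have hd' : H.DiscStep (l k) (l (k + 1)) := by
          by_contra hnd
          exact hd (halt (k + 1) ⟨by omega, by omega⟩ hnd)
        obtain ⟨i, hi⟩ := ih k (by omega) (by omega)
        exact ⟨i + 1, hdisc hi hd' hr hv.symm⟩

/-- Unfolding `Φ^i` gives `i + 1` flows separated by `i` jumps, hence the length `2 * i + 1`; steps
from even to odd indices are flows. -/
theorem IsMF.exists_isTrace [Finite V] {H : HybridAutomaton V d} (hH : H.IsMF)
    (I F : Fml (Fin d)) (i : ℕ) (v v' : V) (p q : Pt d)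
    (h : Holds₂ ((H.franzle I F).reachFml i v v') p q) :
    ∃ l, H.IsTrace (2 * i + 1) l ∧ l 0 = (v, p) ∧ l (2 * i + 1) = (v', q) := by
  suffices hs : ∃ l : ℕ → V × Pt d, (∀ j ≤ 2 * i + 1, H.Admissible (l j)) ∧
      (∀ j ≤ i, H.ContStep (l (2 * j)) (l (2 * j + 1))) ∧
      (∀ j < i, H.DiscStep (l (2 * j + 1)) (l (2 * j + 2))) ∧
      l 0 = (v, p) ∧ l (2 * i + 1) = (v', q) by
    obtain ⟨l, hadm, hc, hd, h0, h1⟩ := hs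
    refine ⟨l, ⟨by omega, hadm, ?_, ?_⟩, h0, h1⟩
    · rintro j ⟨hj1, hj2⟩
      obtain ⟨k, rfl | rfl⟩ : ∃ k, j = 2 * k + 1 ∨ j = 2 * k + 2 := ⟨(j - 1) / 2, by omega⟩
      · exact Or.inl (hc k (by omega))
      · exact Or.inr (hd k (by omega))
    · rintro j ⟨hj1, hj2⟩ hnd
      obtain ⟨k, rfl | rfl⟩ : ∃ k, j = 2 * k + 1 ∨ j = 2 * k + 2 := ⟨(j - 1) / 2, by omega⟩
      · exact hd k (by omega)
      · exact absurd (hd k (by omega)) hnd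
  induction i generalizing v' q with
  | zero =>
    obtain ⟨rfl, hact⟩ := (FranzleAutomaton.holds₂_reachFml_zero _ _ _ _ _).1 h
    have hr := (H.holds₂_reachZero v p q).1 hact
    refine ⟨fun j => if j = 0 then (v, p) else (v, q), ?_, ?_, by simp, by simp, by simp⟩
    · intro j _
      by_cases hj : j = 0
      · simpa [hj, Admissible] using hr.2
      · obtain ⟨T, -, hq⟩ := hr.1
        simpa [hj, Admissible] using hq.2
    · intro j hj
      obtain rfl : j = 0 := by omega
      simpa using hH.contStep hact
  | succ i ih =>
    obtain ⟨u, r, s, h1, h2, h3⟩ := (FranzleAutomaton.holds₂_reachFml_succ _ _ _ _ _ _).1 h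
    obtain ⟨l, hadm, hc, hd, h0, hlast⟩ := ih u r h1
    rw [holds₂_franzle_trans] at h2
    have hr := (H.holds₂_reachZero v' s q).1 h3
    let l' : ℕ → V × Pt d := fun j =>
      if j ≤ 2 * i + 1 then l j else if j = 2 * i + 2 then (v', s) else (v', q)
    have hl : ∀ j ≤ 2 * i + 1, l' j = l j := fun j hj => if_pos hj
    have hs : l' (2 * i + 2) = (v', s) := by simp [l']
    have hq : l' (2 * i + 3) = (v', q) := by simp [l']
    refine ⟨l', ?_, ?_, ?_, ?_, hq⟩
    · intro j hj
      obtain hj | rfl | rfl : j ≤ 2 * i + 1 ∨ j = 2 * i + 2 ∨ j = 2 * i + 3 := by omega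
      · rw [hl j hj]
        exact hadm j hj
      · rw [hs]
        exact hr.2
      · rw [hq]
        obtain ⟨T, -, hq'⟩ := hr.1
        exact hq'.2
    · intro j hj
      obtain hj | rfl := Nat.le_succ_iff.1 hj
      · rw [hl _ (by omega), hl _ (by omega)]
        exact hc j hj
      · rw [show 2 * (i + 1) = 2 * i + 2 by ring, hs, hq]
        exact hH.contStep h3
    · intro j hj
      obtain hj | rfl := Nat.lt_succ_iff_lt_or_eq.1 hj
      · rw [hl _ (by omega), hl _ (by omega)]
        exact hd j hj
      · rw [hl _ le_rfl, hlast, hs]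
        exact h2
    · rw [hl 0 (by omega), h0]

end HybridAutomaton

end HybridReach

/-! ### Reachability and safety -/

theorem mainTheorem2 {V : Type*} [Finite V] {d : ℕ}
    (H : HybridReach.HybridAutomaton V d) (hH : H.IsMF)
    (I F : HybridReach.Fml (Fin d)) (SI SF : Set (HybridReach.Pt d))
    (hI : HybridReach.Represents I SI) (hF : HybridReach.Represents F SF) :
    H.SetReaches SI SF ↔ ¬ (H.franzle I F).IsSafe := by
  subst hI hF
  constructor
  · rintro ⟨s, hs, r, hr, n, l, hl, rfl, rfl⟩ hsafe
    obtain ⟨i, hi⟩ := hl.exists_holds₂_reachFml I F n le_rfl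
    have := hsafe i _ _ _ _ (Formula.realize_inf.2 ⟨hl.2.1 0 (Nat.zero_le n), hs⟩) hi
    exact Formula.realize_not.1 (Formula.realize_inf.1 this).2 hr
  · intro hns
    simp only [HybridReach.FranzleAutomaton.IsSafe, not_forall] at hns
    obtain ⟨i, v, v', p, q, hp, hreach, hq⟩ := hns
    obtain ⟨l, hl, h0, h1⟩ := hH.exists_isTrace I F i v v' p q hreach
    refine ⟨p, (Formula.realize_inf.1 hp).2, q, ?_, 2 * i + 1, l, hl, by rw [h0], by rw [h1]⟩
    -- Unsafety could also mean that the invariant fails; admissibility of the last state excludes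
    -- this, so `F` must hold.
    have hinv := hl.2.1 (2 * i + 1) le_rfl
    rw [h1] at hinv
    by_contra hqF
    exact hq (Formula.realize_inf.2 ⟨hinv, Formula.realize_not.2 hqF⟩)
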